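/- Let $d\ge 3$, $V=\{1,\dots,d\}$, and let $\Gamma\in\mathbb R^{d\times d}$ be a symmetric matrix with zero diagonal and non-negative entries that is strictly conditionally negative definite, i.e. $a^\top\Gamma a<0$ for all $a\in\mathbb R^d\setminus\{0\}$ with $\sum_i a_i=0$. For $k\in V$ put $$\Sigma^{(k)}=\tfrac12\{\Gamma_{ik}+\Gamma_{jk}-\Gamma_{ij}\}_{i,j\in V\setminus\{k\}},\qquad \Theta^{(k)}=(\Sigma^{(k)})^{-1},$$ both indexed by $V\setminus\{k\}$, and for $y\in(0,\infty)^d$ let $$\lambda(y)=y_k^{-2}\prod_{i\ne k}y_i^{-1}\,\phi_{d-1}\big(\{\log(y_i/y_k)+\Gamma_{ik}/2\}_{i\neq k};\Sigma^{(k)}\big),$$ where $\phi_{d-1}(\cdot;\Sigma)$ is the density of the centred normal distribution with covariance matrix $\Sigma$ (the value of $\lambda(y)$ does not depend on $k$). Let $\mathcal L=\{y\in(0,\infty)^d:\max_i y_i>1\}$, and let $Y=(Y_1,\dots,Y_d)$ be a Hüsler--Reiss Pareto random vector with parameter matrix $\Gamma$, i.e. a random vector with density $\lambda(y)/\int_{\mathcal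 L}\lambda$ on $\mathcal L$. For $k\in V$ let $Y^k$ be $Y$ conditioned on $\{Y_k>1\}$, a random vector with a positive continuous density $f^k$ on $\mathcal L^k=\{y\in\mathcal L:y_k>1\}$, and let $f^k_I$ be the marginal density of $Y^k_I=(Y^k_i)_{i\in I}$. For a partition of $V$ into non-empty sets $A,B,C$ write $Y_A\perp_e Y_C\mid Y_B$ if for every $k\in V$ the vectors $Y^k_A$ and $Y^k_C$ are conditionally independent given $Y^k_B$, i.e. $f^k(y)=f^k_{A\cup B}(y_{A\cup B})f^k_{B\cup C}(y_{B\cup C})/f^k_B(y_B)$ for all $y\in\mathcal L^k$. Then for all $i,j\in V$ with $i\ne j$ and any $k\in V$, $$Y_i\perp_e Y_j\mid Y_{V\setminus\{i,j\}}\iff\begin{cases}\Theta^{(k)}_{ij}=0,&\text{if } i,j\ne k,\\ \sum_{l\ne k}\Theta^{(k)}_{lj}=0,&\text{if } i=k,\ j\neq k,\\ \sum_{l\neq k}\Theta^{(k)}_{il}=0,&\text{if } j=k,\ i\ne k.\end{cases}$$ -/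

import Mathlib

open MeasureTheory ProbabilityTheory
open scoped ENNReal Matrix

namespace ExtremalGraph

noncomputable section

variable {d : ℕ}

/-- Admissible parameter matrices of the Hüsler--Reiss family: symmetric, with zero diagonal,
non-negative entries, and strictly conditionally negative definite. -/
structure IsVariogram (Γ : Matrix (Fin d) (Fin d) ℝ) : Prop where
  symm : Γ.IsSymm
  diag_zero : ∀ i, Γ i i = 0
  nonneg : ∀ i j, 0 ≤ Γ i j
  neg_def : ∀ a : Fin d → ℝ, a ≠ 0 → ∑ i, a i = 0 → a ⬝ᵥ (Γ *ᵥ a) < 0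

/-- The matrix `Σ^(k)`, with rows and columns indexed by the elements different from `k`. -/
def sigma (Γ : Matrix (Fin d) (Fin d) ℝ) (k : Fin d) :
    Matrix {l : Fin d // l ≠ k} {l : Fin d // l ≠ k} ℝ :=
  Matrix.of fun i j => (Γ i k + Γ j k - Γ i j) / 2

/-- The precision matrix `Θ^(k)`, the inverse of `Σ^(k)`. -/
def theta (Γ : Matrix (Fin d) (Fin d) ℝ) (k : Fin d) :
    Matrix {l : Fin d // l ≠ k} {l : Fin d // l ≠ k} ℝ :=
  (sigma Γ k)⁻¹

/-- The density of the centred normal distribution with (positive definite) covariance `S`. -/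
def normalDensity {n : Type} [Fintype n] [DecidableEq n] (S : Matrix n n ℝ) (x : n → ℝ) : ℝ :=
  (Real.sqrt ((2 * Real.pi) ^ Fintype.card n * S.det))⁻¹ * Real.exp (-(x ⬝ᵥ (S⁻¹ *ᵥ x)) / 2)

/-- The Hüsler--Reiss exponent measure density, written relative to the coordinate `k`
(for an admissible `Γ` and `y` with positive coordinates its value does not depend on `k`). -/
def hrDensity (Γ : Matrix (Fin d) (Fin d) ℝ) (k : Fin d) (y : Fin d → ℝ) : ℝ :=
  ((y k) ^ 2)⁻¹ * (∏ i : {l : Fin d // l ≠ k}, (y i)⁻¹) *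
    normalDensity (sigma Γ k) (fun i => Real.log (y i / y k) + Γ i k / 2)

/-- The L-shaped space of all vectors with positive coordinates, at least one of which
exceeds one. -/
def lSpace (d : ℕ) : Set (Fin d → ℝ) := {y | (∀ i, 0 < y i) ∧ ∃ i, 1 < y i}

/-- The product space of all elements of the L-shaped space whose `k`-th coordinate exceeds one. -/
def lSpaceAt (k : Fin d) : Set (Fin d → ℝ) := {y | y ∈ lSpace d ∧ 1 < y k}

/-- The extremal coefficient `Λ(1)`: the mass that the exponent measure gives to the vectors that
exceed one in at least one coordinate. -/
def hrCoefficient (Γ : Matrix (Fin d) (Fin d) ℝ) (k : Fin d) : ℝ≥0∞ :=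
  ∫⁻ y in lSpace d, ENNReal.ofReal (hrDensity Γ k y)

/-- The probability law on the L-shaped space with Lebesgue density `λ / Λ(1)`. -/
def hrParetoLaw (Γ : Matrix (Fin d) (Fin d) ℝ) (k : Fin d) : Measure (Fin d → ℝ) :=
  (volume.restrict (lSpace d)).withDensity fun y =>
    ENNReal.ofReal (hrDensity Γ k y) / hrCoefficient Γ k

/-- `Y` is a Hüsler--Reiss Pareto random vector with parameter matrix `Γ`. The coordinate used to
write down the density is immaterial, so any one of them is allowed. -/
def IsHRPareto {Ω : Type*} [MeasurableSpace Ω] (P : Measure Ω) (Y : Ω → Fin d → ℝ)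
    (Γ : Matrix (Fin d) (Fin d) ℝ) : Prop :=
  ∃ m : Fin d, HasLaw Y (hrParetoLaw Γ m) P

/-- The function `f` on the state space `X`, extended by zero. -/
def extend (X : Set (Fin d → ℝ)) (f : (Fin d → ℝ) → ℝ) : (Fin d → ℝ) → ℝ≥0∞ :=
  X.indicator fun x => ENNReal.ofReal (f x)

/-- The law `ν` has the positive and continuous Lebesgue density `f` on the state space `X`. -/
structure HasPosContDensity (ν : Measure (Fin d → ℝ)) (X : Set (Fin d → ℝ))
    (f : (Fin d → ℝ) → ℝ) : Prop where
  continuousOn : ContinuousOn f X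
  pos : ∀ x ∈ X, 0 < f x
  law : ν = volume.withDensity (extend X f)

/-- The marginal density `f_I`, obtained by integrating out all coordinates outside `I`; it
depends on `x` only through the coordinates in `I`. -/
def marginal (X : Set (Fin d → ℝ)) (f : (Fin d → ℝ) → ℝ) (I : Finset (Fin d)) :
    (Fin d → ℝ) → ℝ≥0∞ :=
  lmarginal (fun _ => volume) Iᶜ (extend X f)

/-- Classical conditional independence of the coordinates in `A` and in `C` given those in `B`,
for disjoint `A`, `B`, `C` with union everything and a law with a positive and continuous density
on a product space `X`: the density factorizes as `f = f_{A ∪ B} f_{B ∪ C} / f_B` on `X`. -/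
def CondIndepLaw (ν : Measure (Fin d → ℝ)) (X : Set (Fin d → ℝ)) (A B C : Finset (Fin d)) :
    Prop :=
  ∃ f : (Fin d → ℝ) → ℝ, HasPosContDensity ν X f ∧
    ∀ x ∈ X, ENNReal.ofReal (f x) =
      marginal X f (A ∪ B) x * marginal X f (B ∪ C) x / marginal X f B x

/-- The law of `Y^k`, that is, of `Y` conditioned on the event that its `k`-th coordinate
exceeds one. -/
def conditionedLaw {Ω : Type*} [MeasurableSpace Ω] (P : Measure Ω) (Y : Ω → Fin d → ℝ)
    (k : Fin d) : Measure (Fin d → ℝ) :=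
  (cond P {ω | 1 < Y ω k}).map Y

/-- Extremal conditional independence of `Y_A` and `Y_C` given `Y_B`, for non-empty disjoint sets
`A`, `B`, `C` whose union is everything: for every `k`, the vector `Y^k` satisfies classical
conditional independence. -/
def ExtremalCondIndep {Ω : Type*} [MeasurableSpace Ω] (P : Measure Ω) (Y : Ω → Fin d → ℝ)
    (A B C : Finset (Fin d)) : Prop :=
  ∀ k : Fin d, CondIndepLaw (conditionedLaw P Y k) (lSpaceAt k) A B C

end

end ExtremalGraph

/-! In the coordinates `u = log y` the density is the exponential of a quadratic polynomial with
quadratic part `-uᵀ T u / 2`, where `T = precision Γ k` is `Θ^(k)` bordered so that all rows and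
columns sum to zero. `T` does not depend on `k` (`IsVariogram.precision_eq`): up to the factor `-2`
it inverts `Γ` on the vectors with sum zero.

Conditioning on `{Y_k > 1}` changes only the normalization and leaves a product domain. There,
conditional independence of two coordinates given the rest means that `f` satisfies the rectangle
identity `f(x_st) f(x) = f(x_s) f(x_t)` when coordinates `i` and `j` are moved. The mixed second
difference of the exponent is `-T i j` times the two log increments, so the identity amounts to `T i
j = 0` (`condIndepLaw_orthant_iff`), the same condition for every `k`. Off the index `k` the entries
of `T` are those of `Θ^(k)`; in row or column `k` they are negated sums. -/

namespace ExtremalGraph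

/-! ### The common precision matrix -/

/-- The matrix of the linear map `u ↦ (u l - u k)_{l ≠ k}`. -/
def contrast {d : ℕ} (k : Fin d) : Matrix {l : Fin d // l ≠ k} (Fin d) ℝ :=
  Matrix.of fun l i => (Pi.single (l : Fin d) 1 : Fin d → ℝ) i - (Pi.single k 1 : Fin d → ℝ) i

/-- The extension of `Θ^(k)` to a `d × d` matrix whose rows and columns sum to zero. -/
noncomputable def precision {d : ℕ} (Γ : Matrix (Fin d) (Fin d) ℝ) (k : Fin d) :
    Matrix (Fin d) (Fin d) ℝ :=
  (contrast k)ᵀ * theta Γ k * contrast k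

/-- A quadratic polynomial with quadratic part `-uᵀ T u / 2`. -/
noncomputable def quadPoly {n : Type*} [Fintype n] (T : Matrix n n ℝ) (b : n → ℝ) (c : ℝ)
    (u : n → ℝ) : ℝ :=
  -(u ⬝ᵥ T *ᵥ u) / 2 + b ⬝ᵥ u + c

theorem contrast_mulVec {d : ℕ} (k : Fin d) (u : Fin d → ℝ) (l : {l : Fin d // l ≠ k}) :
    (contrast k *ᵥ u) l = u l - u k := by
  simp [contrast, Matrix.mulVec, dotProduct, sub_mul, Pi.single_apply]

theorem contrast_transpose_mulVec_of_ne {d : ℕ} {k : Fin d} (a : {l : Fin d // l ≠ k} → ℝ)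
    (l : {l : Fin d // l ≠ k}) : ((contrast k)ᵀ *ᵥ a) l = a l := by
  have h : ∀ x : {l : Fin d // l ≠ k}, ((l : Fin d) = x) = (l = x) := fun x => by
    rw [Subtype.ext_iff]
  simp [contrast, Matrix.mulVec, dotProduct, Pi.single_apply, l.2, h]

theorem sum_contrast_transpose_mulVec {d : ℕ} {k : Fin d} (a : {l : Fin d // l ≠ k} → ℝ) :
    ∑ i, ((contrast k)ᵀ *ᵥ a) i = 0 := by
  simp only [contrast, Matrix.mulVec, dotProduct, Matrix.transpose_apply, Matrix.of_apply]
  rw [Finset.sum_comm]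
  refine Finset.sum_eq_zero fun l _ => ?_
  rw [← Finset.sum_mul]
  simp

theorem contrast_transpose_mulVec_self {d : ℕ} {k : Fin d} (a : {l : Fin d // l ≠ k} → ℝ) :
    ((contrast k)ᵀ *ᵥ a) k = -∑ l, a l := by
  have h : ∀ x : {l : Fin d // l ≠ k}, (k = (x : Fin d)) = False := fun x => by
    simpa using x.2.symm
  simp [contrast, Matrix.mulVec, dotProduct, Pi.single_apply, h]

theorem eq_contrast_transpose_mulVec {d : ℕ} (k : Fin d) {v : Fin d → ℝ} (hv : ∑ i, v i = 0) :
    v = (contrast k)ᵀ *ᵥ fun l => v l := by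
  ext i
  by_cases hi : i = k
  · subst hi
    rw [contrast_transpose_mulVec_self]
    have := Fintype.sum_eq_add_sum_subtype_ne v i
    linarith
  · exact (contrast_transpose_mulVec_of_ne (fun l => v l) ⟨i, hi⟩).symm

variable {d : ℕ} {Γ : Matrix (Fin d) (Fin d) ℝ}

/-- Carries negative definiteness of `Γ` on the vectors with sum zero, the range of `(contrast k)ᵀ`,
over to positive definiteness of `Σ^(k)`. -/
theorem IsVariogram.sigma_eq (hΓ : IsVariogram Γ) (k : Fin d) :
    sigma Γ k = (-(1 / 2 : ℝ)) • (contrast k * Γ * (contrast k)ᵀ) := by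
  ext l m
  have h1 : ∀ (j : Fin d), (contrast k * Γ) l j = Γ l j - Γ k j := fun j =>
    contrast_mulVec k (fun i => Γ i j) l
  have h2 : (contrast k * Γ * (contrast k)ᵀ) l m =
      (contrast k * Γ) l m - (contrast k * Γ) l k := by
    rw [← contrast_mulVec k (fun i => (contrast k * Γ) l i) m]
    simp [Matrix.mul_apply, Matrix.mulVec, dotProduct, mul_comm]
  rw [Matrix.smul_apply, h2, h1, h1, hΓ.diag_zero, ← hΓ.symm.apply k m]
  simp [sigma]
  ring

theorem IsVariogram.sigma_posDef (hΓ : IsVariogram Γ) (k : Fin d) : (sigma Γ k).PosDef := by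
  refine Matrix.PosDef.of_dotProduct_mulVec_pos ?_ ?_
  · ext l m
    simp [sigma, hΓ.symm.apply (l : Fin d) m]
    ring
  · intro a ha
    have hne : (contrast k)ᵀ *ᵥ a ≠ 0 := by
      intro h
      apply ha
      ext l
      rw [← contrast_transpose_mulVec_of_ne a l, h]
      rfl
    have := hΓ.neg_def _ hne (sum_contrast_transpose_mulVec a)
    rw [hΓ.sigma_eq, Matrix.smul_mulVec, dotProduct_smul, ← Matrix.mulVec_mulVec,
      ← Matrix.mulVec_mulVec, Matrix.dotProduct_mulVec, ← Matrix.mulVec_transpose]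
    simp only [star_trivial, smul_eq_mul]
    linarith

theorem IsVariogram.theta_posDef (hΓ : IsVariogram Γ) (k : Fin d) : (theta Γ k).PosDef :=
  (hΓ.sigma_posDef k).inv

theorem IsVariogram.theta_symm (hΓ : IsVariogram Γ) (k : Fin d) : (theta Γ k)ᵀ = theta Γ k := by
  simpa [Matrix.IsHermitian, Matrix.conjTranspose_eq_transpose_of_trivial] using
    (hΓ.theta_posDef k).isHermitian

theorem IsVariogram.precision_symm (hΓ : IsVariogram Γ) (k : Fin d) :
    (precision Γ k)ᵀ = precision Γ k := by
  simp [precision, Matrix.transpose_mul, hΓ.theta_symm, Matrix.mul_assoc]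

/-- With `v = (contrast k)ᵀ a`, the product contains `contrast k * Γ * (contrast k)ᵀ = -2 Σ^(k)`,
which `Θ^(k)` cancels. -/
theorem IsVariogram.precision_mul_mulVec (hΓ : IsVariogram Γ) (k : Fin d) {v : Fin d → ℝ}
    (hv : ∑ i, v i = 0) : (precision Γ k * Γ) *ᵥ v = (-2 : ℝ) • v := by
  have h : contrast k * Γ * (contrast k)ᵀ = (-2 : ℝ) • sigma Γ k := by
    rw [hΓ.sigma_eq, smul_smul]
    norm_num
  have hinv : theta Γ k * sigma Γ k = 1 :=
    Matrix.nonsing_inv_mul _ (hΓ.sigma_posDef k).det_pos.ne'.isUnit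
  rw [eq_contrast_transpose_mulVec k hv, Matrix.mulVec_mulVec, ← Matrix.smul_mulVec]
  congr 1
  calc precision Γ k * Γ * (contrast k)ᵀ
      = (contrast k)ᵀ * theta Γ k * (contrast k * Γ * (contrast k)ᵀ) := by
        simp only [precision, Matrix.mul_assoc]
    _ = (-2 : ℝ) • (contrast k)ᵀ := by
        rw [h, Matrix.mul_smul, Matrix.mul_assoc, hinv, Matrix.mul_one]

theorem IsVariogram.precision_mul_mul_precision (hΓ : IsVariogram Γ) (k m : Fin d) :
    precision Γ k * Γ * precision Γ m = (-2 : ℝ) • precision Γ m := by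
  refine Matrix.ext_of_mulVec_single fun j => ?_
  rw [← Matrix.mulVec_mulVec, Matrix.smul_mulVec]
  refine hΓ.precision_mul_mulVec k ?_
  rw [precision, Matrix.mul_assoc, ← Matrix.mulVec_mulVec]
  exact sum_contrast_transpose_mulVec _

/-- By symmetry `precision Γ k * Γ * precision Γ m` can be reduced from either side, to `-2` times
either outer factor. -/
theorem IsVariogram.precision_eq (hΓ : IsVariogram Γ) (k m : Fin d) :
    precision Γ k = precision Γ m := by
  have h1 := hΓ.precision_mul_mul_precision k m
  have h2 := congrArg Matrix.transpose (hΓ.precision_mul_mul_precision m k)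
  rw [Matrix.transpose_mul, Matrix.transpose_mul, Matrix.transpose_smul, hΓ.precision_symm,
    hΓ.precision_symm, hΓ.symm.eq, ← Matrix.mul_assoc, h1] at h2
  exact (smul_right_injective _ (by norm_num : (-2 : ℝ) ≠ 0) h2).symm

theorem precision_apply_of_ne (k : Fin d) (l m : {l : Fin d // l ≠ k}) :
    precision Γ k l m = theta Γ k l m := by
  have h1 : ∀ x, ((contrast k)ᵀ * theta Γ k) l x = theta Γ k l x := fun x =>
    contrast_transpose_mulVec_of_ne (fun y => theta Γ k y x) l
  have h2 : precision Γ k l m = ((contrast k)ᵀ *ᵥ (((contrast k)ᵀ * theta Γ k) l)) m := by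
    simp only [precision, Matrix.mul_apply, Matrix.mulVec, dotProduct, Matrix.transpose_apply,
      mul_comm]
  rw [h2, contrast_transpose_mulVec_of_ne, h1]

theorem precision_apply_self_right (k : Fin d) (l : {l : Fin d // l ≠ k}) :
    precision Γ k l k = -∑ m, theta Γ k l m := by
  have h1 : ∀ x, ((contrast k)ᵀ * theta Γ k) l x = theta Γ k l x := fun x =>
    contrast_transpose_mulVec_of_ne (fun y => theta Γ k y x) l
  have h2 : precision Γ k l k = ((contrast k)ᵀ *ᵥ (((contrast k)ᵀ * theta Γ k) l)) k := by
    simp only [precision, Matrix.mul_apply, Matrix.mulVec, dotProduct, Matrix.transpose_apply,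
      mul_comm]
  rw [h2, contrast_transpose_mulVec_self]
  simp only [h1]

theorem IsVariogram.precision_apply_self_left (hΓ : IsVariogram Γ) (k : Fin d)
    (l : {l : Fin d // l ≠ k}) : precision Γ k k l = -∑ m, theta Γ k m l := by
  rw [← hΓ.precision_symm, Matrix.transpose_apply, precision_apply_self_right]
  congr 1
  refine Finset.sum_congr rfl fun m _ => ?_
  conv_lhs => rw [← hΓ.theta_symm, Matrix.transpose_apply]

/-- Rebasing at some `j ≠ i` exhibits the entry as a diagonal entry of the positive definite
`Θ^(j)`, even when `i = k`. -/
theorem IsVariogram.precision_diag_pos (hΓ : IsVariogram Γ) (k : Fin d) {i j : Fin d}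
    (hij : i ≠ j) : 0 < precision Γ k i i := by
  rw [hΓ.precision_eq k j, precision_apply_of_ne j ⟨i, hij⟩ ⟨i, hij⟩]
  exact (hΓ.theta_posDef j).diag_pos

/-! ### Quadratic polynomials and the density in logarithmic coordinates -/

theorem quadPoly_add_single {n : Type*} [Fintype n] [DecidableEq n] {T : Matrix n n ℝ}
    (hT : Tᵀ = T) (b : n → ℝ) (c : ℝ) (u : n → ℝ) (i : n) (s : ℝ) :
    quadPoly T b c (u + Pi.single i s) =
      quadPoly T b c u + (b i - (T *ᵥ u) i) * s - T i i / 2 * s ^ 2 := by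
  have h : u ⬝ᵥ T *ᵥ Pi.single i s = (T *ᵥ u) i * s := by
    rw [Matrix.dotProduct_mulVec, ← Matrix.mulVec_transpose, hT, dotProduct_single]
  have h2 : (T *ᵥ Pi.single i s) i = T i i * s := by simp [Matrix.mulVec_single]
  simp only [quadPoly, Matrix.mulVec_add, dotProduct_add, add_dotProduct, h, single_dotProduct,
    dotProduct_single, h2]
  ring

theorem quadPoly_add_single_add_single {n : Type*} [Fintype n] [DecidableEq n]
    {T : Matrix n n ℝ} (hT : Tᵀ = T) (b : n → ℝ) (c : ℝ) (u : n → ℝ) (i j : n) (s t : ℝ) :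
    quadPoly T b c (u + Pi.single i s + Pi.single j t) + quadPoly T b c u =
      quadPoly T b c (u + Pi.single i s) + quadPoly T b c (u + Pi.single j t) -
        T i j * s * t := by
  have h2 : (T *ᵥ Pi.single i s) j = T i j * s := by
    simp only [Matrix.mulVec_single]
    conv_rhs => rw [← hT]
    simp
  rw [quadPoly_add_single hT b c (u + _) j, quadPoly_add_single hT b c u j, Matrix.mulVec_add,
    Pi.add_apply, h2]
  ring

theorem IsVariogram.exists_hrDensity_eq (hΓ : IsVariogram Γ) (k : Fin d) :
    ∃ b c, ∀ y : Fin d → ℝ, (∀ i, 0 < y i) →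
      hrDensity Γ k y = Real.exp (quadPoly (precision Γ k) b c fun i => Real.log (y i)) := by
  set g : {l : Fin d // l ≠ k} → ℝ := fun i => Γ i k / 2
  set K : ℝ := (Real.sqrt ((2 * Real.pi) ^ Fintype.card {l : Fin d // l ≠ k} *
    (sigma Γ k).det))⁻¹
  have hK : 0 < K := by
    have := (hΓ.sigma_posDef k).det_pos
    positivity
  -- The monomial prefactor has exponent `-1` in each coordinate and `-2` in coordinate `k`; the
  -- rest of `b` is the cross term of the shift `g`.
  refine ⟨fun i => -(1 + (Pi.single k 1 : Fin d → ℝ) i) -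
    ((contrast k)ᵀ *ᵥ (theta Γ k *ᵥ g)) i, Real.log K - (g ⬝ᵥ theta Γ k *ᵥ g) / 2, ?_⟩
  intro y hy
  set u : Fin d → ℝ := fun i => Real.log (y i)
  have hyu : ∀ i, y i = Real.exp (u i) := fun i => (Real.exp_log (hy i)).symm
  have hx : (fun i : {l : Fin d // l ≠ k} => Real.log (y i / y k) + Γ i k / 2) =
      contrast k *ᵥ u + g := by
    ext l
    rw [Pi.add_apply, contrast_mulVec, Real.log_div (hy _).ne' (hy _).ne']
  have hform : (contrast k *ᵥ u + g) ⬝ᵥ theta Γ k *ᵥ (contrast k *ᵥ u + g) =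
      u ⬝ᵥ precision Γ k *ᵥ u + 2 * ((contrast k)ᵀ *ᵥ (theta Γ k *ᵥ g)) ⬝ᵥ u +
        g ⬝ᵥ theta Γ k *ᵥ g := by
    have e1 : (contrast k *ᵥ u) ⬝ᵥ theta Γ k *ᵥ (contrast k *ᵥ u) =
        u ⬝ᵥ precision Γ k *ᵥ u := by
      rw [precision, ← Matrix.mulVec_mulVec, ← Matrix.mulVec_mulVec,
        Matrix.dotProduct_mulVec u, ← Matrix.mulVec_transpose, Matrix.transpose_transpose]
    have e2 : (contrast k *ᵥ u) ⬝ᵥ theta Γ k *ᵥ g =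
        ((contrast k)ᵀ *ᵥ (theta Γ k *ᵥ g)) ⬝ᵥ u := by
      rw [dotProduct_comm, Matrix.dotProduct_mulVec, ← Matrix.mulVec_transpose]
    have e3 : g ⬝ᵥ theta Γ k *ᵥ (contrast k *ᵥ u) =
        ((contrast k)ᵀ *ᵥ (theta Γ k *ᵥ g)) ⬝ᵥ u := by
      rw [Matrix.dotProduct_mulVec, ← Matrix.mulVec_transpose, hΓ.theta_symm, dotProduct_comm, e2]
    simp only [Matrix.mulVec_add, dotProduct_add, add_dotProduct, e1, e2, e3]
    ring
  have hprod : ((y k) ^ 2)⁻¹ * (∏ i : {l : Fin d // l ≠ k}, (y i)⁻¹) =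
      Real.exp ((fun i => -(1 + (Pi.single k 1 : Fin d → ℝ) i)) ⬝ᵥ u) := by
    have : (fun i => -(1 + (Pi.single k 1 : Fin d → ℝ) i)) ⬝ᵥ u =
        -u k - u k - ∑ i : {l : Fin d // l ≠ k}, u i := by
      have := Fintype.sum_eq_add_sum_subtype_ne u k
      simp only [dotProduct, neg_mul, add_mul, one_mul, Finset.sum_neg_distrib,
        Finset.sum_add_distrib, Pi.single_apply, ite_mul, zero_mul, Finset.sum_ite_eq',
        Finset.mem_univ, if_true]
      linarith
    rw [this, sub_eq_add_neg _ (∑ i : {l : Fin d // l ≠ k}, u i), ← Finset.sum_neg_distrib,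
      Real.exp_add, Real.exp_sum]
    simp only [hyu, Real.exp_neg, Real.exp_sub]
    congr 1
    rw [pow_two, mul_inv]
    rfl
  rw [hrDensity, hprod, hx, normalDensity]
  change _ * (K * Real.exp (-((contrast k *ᵥ u + g) ⬝ᵥ theta Γ k *ᵥ (contrast k *ᵥ u + g)) / 2))
    = _
  rw [hform]
  nth_rewrite 1 [← Real.exp_log hK]
  rw [← Real.exp_add, ← Real.exp_add, quadPoly]
  congr 1
  have : ∀ v w : Fin d → ℝ, (fun i => v i - w i) ⬝ᵥ u = v ⬝ᵥ u - w ⬝ᵥ u := fun v w =>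
    sub_dotProduct v w u
  rw [this (fun i => -(1 + (Pi.single k 1 : Fin d → ℝ) i))]
  ring

/-- The exponential of a quadratic polynomial in the logarithms of the coordinates. -/
noncomputable def expQuadLog {n : Type*} [Fintype n] (T : Matrix n n ℝ) (b : n → ℝ) (c : ℝ)
    (y : n → ℝ) : ℝ :=
  Real.exp (quadPoly T b c fun i => Real.log (y i))

theorem log_update {n : Type*} [DecidableEq n] (x : n → ℝ) (i : n) (s : ℝ) :
    (fun l => Real.log (Function.update x i s l)) =
      (fun l => Real.log (x l)) + Pi.single i (Real.log s - Real.log (x i)) := by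
  ext l
  by_cases h : l = i
  · subst h; simp
  · simp [h]

section ExpQuadLog

variable {n : Type*} [Fintype n] {T : Matrix n n ℝ} {b : n → ℝ} {c : ℝ}

theorem expQuadLog_pos (y : n → ℝ) : 0 < expQuadLog T b c y := Real.exp_pos _

theorem continuous_quadPoly : Continuous (quadPoly T b c) := by
  unfold quadPoly
  fun_prop

theorem measurable_expQuadLog : Measurable (expQuadLog T b c) :=
  Real.measurable_exp.comp (continuous_quadPoly.measurable.comp
    (measurable_pi_lambda _ fun i => Real.measurable_log.comp (measurable_pi_apply i)))

theorem continuousOn_expQuadLog : ContinuousOn (expQuadLog T b c) {y | ∀ i, 0 < y i} := by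
  refine Real.continuous_exp.comp_continuousOn (continuous_quadPoly.comp_continuousOn ?_)
  exact continuousOn_pi.2 fun i => (continuous_apply i).continuousOn.log fun y hy => (hy i).ne'

theorem expQuadLog_add_const (r : ℝ) (y : n → ℝ) :
    expQuadLog T b (c + r) y = Real.exp r * expQuadLog T b c y := by
  rw [expQuadLog, expQuadLog, ← Real.exp_add, quadPoly, quadPoly]
  ring_nf

variable [DecidableEq n]

theorem expQuadLog_update_update (hT : Tᵀ = T) {i j : n} (hij : i ≠ j) (x : n → ℝ) (s t : ℝ) :
    expQuadLog T b c (Function.update (Function.update x i s) j t) * expQuadLog T b c x =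
      expQuadLog T b c (Function.update x i s) * expQuadLog T b c (Function.update x j t) *
        Real.exp (-(T i j * (Real.log s - Real.log (x i)) * (Real.log t - Real.log (x j)))) := by
  simp only [expQuadLog, ← Real.exp_add, log_update, Function.update_of_ne hij.symm]
  rw [quadPoly_add_single_add_single hT]
  ring_nf

theorem exp_quadratic_le {p q r σ : ℝ} (hr : 0 < r) :
    Real.exp (p + q * σ - r * σ ^ 2) ≤ Real.exp (p + q ^ 2 / (4 * r)) := by
  rw [Real.exp_le_exp]
  have : q * σ - r * σ ^ 2 = q ^ 2 / (4 * r) - r * (σ - q / (2 * r)) ^ 2 := by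
    field_simp
    ring
  have := mul_nonneg hr.le (sq_nonneg (σ - q / (2 * r)))
  linarith

/-- Multiplying by `s ^ 2 = exp (2 log s)` only shifts the linear coefficient of a concave quadratic
in `log s`, so both `f` and `s ^ 2 * f` are bounded; this gives an integrable majorant. -/
theorem exists_expQuadLog_update_le (hT : Tᵀ = T) {i : n} (hi : 0 < T i i) (x : n → ℝ) :
    ∃ C, ∀ s, 0 < s → expQuadLog T b c (Function.update x i s) ≤ C * (1 + s ^ 2)⁻¹ := by
  set u : n → ℝ := fun l => Real.log (x l)
  set p := quadPoly T b c u
  set q := b i - (T *ᵥ u) i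
  set r := T i i / 2
  have hr : 0 < r := half_pos hi
  refine ⟨Real.exp (p + q ^ 2 / (4 * r)) +
    Real.exp (p + 2 * u i + (q + 2) ^ 2 / (4 * r)), fun s hs => ?_⟩
  rw [← div_eq_mul_inv, le_div_iff₀ (by positivity), mul_add, mul_one]
  have h0 : expQuadLog T b c (Function.update x i s) =
      Real.exp (p + q * (Real.log s - u i) - r * (Real.log s - u i) ^ 2) := by
    rw [expQuadLog, log_update, quadPoly_add_single hT]
  have h1 : s ^ 2 = Real.exp (2 * Real.log s) := by
    rw [two_mul, Real.exp_add, Real.exp_log hs, pow_two]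
  refine add_le_add ?_ ?_
  · rw [h0]
    exact exp_quadratic_le hr
  · rw [h0, h1, ← Real.exp_add]
    refine le_of_eq_of_le ?_ (exp_quadratic_le (σ := Real.log s - u i) hr)
    ring_nf

end ExpQuadLog

variable {d : ℕ}

/-! ### Uniqueness of the density and the rectangle identity -/

/-- Continuity on an open set upgrades almost everywhere equality to equality, so the existential in
`CondIndepLaw` can be tested on any one density. -/
theorem HasPosContDensity.extend_eq {ν : Measure (Fin d → ℝ)} {X : Set (Fin d → ℝ)}
    (hX : IsOpen X) {f g : (Fin d → ℝ) → ℝ} (hf : HasPosContDensity ν X f)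
    (hg : HasPosContDensity ν X g) : extend X f = extend X g := by
  have hm : ∀ {f : (Fin d → ℝ) → ℝ}, HasPosContDensity ν X f →
      AEMeasurable (extend X f) volume := fun hf =>
    (aemeasurable_indicator_iff hX.measurableSet).2
      (hf.continuousOn.aemeasurable hX.measurableSet).ennreal_ofReal
  have h1 : extend X f =ᵐ[volume] extend X g :=
    (withDensity_eq_iff_of_sigmaFinite (hm hf) (hm hg)).1 (hf.law.symm.trans hg.law)
  have h2 : f =ᵐ[volume.restrict X] g := by
    filter_upwards [ae_restrict_of_ae h1, ae_restrict_mem hX.measurableSet] with x hx hxX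
    simp only [extend, Set.indicator_of_mem hxX] at hx
    exact (ENNReal.ofReal_eq_ofReal_iff (hf.pos x hxX).le (hg.pos x hxX).le).1 hx
  have h3 := Measure.eqOn_open_of_ae_eq h2 hX hf.continuousOn hg.continuousOn
  exact Set.indicator_congr fun x hx => by rw [h3 hx]

theorem condIndepLaw_iff_of_hasPosContDensity {ν : Measure (Fin d → ℝ)} {X : Set (Fin d → ℝ)}
    (hX : IsOpen X) {f : (Fin d → ℝ) → ℝ} (hf : HasPosContDensity ν X f)
    (A B C : Finset (Fin d)) :
    CondIndepLaw ν X A B C ↔ ∀ x ∈ X, ENNReal.ofReal (f x) =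
      marginal X f (A ∪ B) x * marginal X f (B ∪ C) x / marginal X f B x := by
  refine ⟨?_, fun h => ⟨f, hf, h⟩⟩
  rintro ⟨g, hg, h⟩ x hx
  have he := hf.extend_eq hX hg
  have hfg : ENNReal.ofReal (f x) = ENNReal.ofReal (g x) := by
    simpa [extend, Set.indicator_of_mem hx] using congrFun he x
  rw [hfg, h x hx]
  simp only [marginal, he]

/-- Conditional independence given all the other coordinates forces the density to factorize
over the corners of rectangles. -/
theorem mul_eq_mul_of_forall_eq_marginal {X : Set (Fin d → ℝ)} {f : (Fin d → ℝ) → ℝ}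
    {i j : Fin d} (hij : i ≠ j)
    (h : ∀ x ∈ X, ENNReal.ofReal (f x) = marginal X f ({i} ∪ {i, j}ᶜ) x *
      marginal X f ({i, j}ᶜ ∪ {j}) x / marginal X f {i, j}ᶜ x)
    {x : Fin d → ℝ} {s t : ℝ} (hx : x ∈ X) (hs : Function.update x i s ∈ X)
    (ht : Function.update x j t ∈ X)
    (hst : Function.update (Function.update x i s) j t ∈ X) :
    ENNReal.ofReal (f (Function.update (Function.update x i s) j t)) * ENNReal.ofReal (f x) =
      ENNReal.ofReal (f (Function.update x i s)) *
        ENNReal.ofReal (f (Function.update x j t)) := by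
  -- A marginal is constant in the coordinates integrated out, so both sides of the goal become the
  -- same product; nothing has to be cancelled, so no finiteness is needed.
  have hmarg : ∀ (I : Finset (Fin d)) (l : Fin d), l ∉ I → ∀ y r,
      marginal X f I (Function.update y l r) = marginal X f I y := fun I l hl y r =>
    lmarginal_update_of_mem _ (Finset.mem_compl.2 hl) _ _ _
  have hj : j ∉ ({i} ∪ {i, j}ᶜ : Finset (Fin d)) := by simp [hij.symm]
  have hi : i ∉ ({i, j}ᶜ ∪ {j} : Finset (Fin d)) := by simp [hij]
  have hi' : i ∉ ({i, j}ᶜ : Finset (Fin d)) := by simp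
  have hj' : j ∉ ({i, j}ᶜ : Finset (Fin d)) := by simp
  rw [h _ hx, h _ hs, h _ ht, h _ hst, hmarg _ _ hj', hmarg _ _ hj', hmarg _ _ hi',
    hmarg _ _ hj, hmarg _ _ hj, hmarg _ _ hi, Function.update_comm hij, hmarg _ _ hi]
  simp only [div_eq_mul_inv]
  ring

/-- Integrate the rectangle identity over `s` and `t`: its right side separates the variables. -/
theorem lmarginal_pair_mul {F : (Fin d → ℝ) → ℝ≥0∞} (hF : Measurable F) {i j : Fin d}
    (hij : i ≠ j) {x : Fin d → ℝ} (hx : F x ≠ ∞)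
    (hrect : ∀ s t, F (Function.update (Function.update x i s) j t) * F x =
      F (Function.update x i s) * F (Function.update x j t)) :
    lmarginal (fun _ => volume) {i, j} F x * F x =
      lmarginal (fun _ => volume) {i} F x * lmarginal (fun _ => volume) {j} F x := by
  rw [lmarginal_insert _ hF (by simpa using hij)]
  simp only [lmarginal_singleton]
  rw [← lintegral_mul_const' _ _ hx,
    ← lintegral_mul_const (f := fun s => F (Function.update x i s)) _
      (hF.comp (measurable_update x))]
  refine lintegral_congr fun s => ?_
  rw [← lintegral_mul_const' _ _ hx,
    ← lintegral_const_mul (f := fun t => F (Function.update x j t)) _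
      (hF.comp (measurable_update x))]
  exact lintegral_congr fun t => hrect s t

/-! ### Conditional independence on an orthant -/

/-- The open box of all vectors that exceed `a` in every coordinate. -/
def orthant (a : Fin d → ℝ) : Set (Fin d → ℝ) := {y | ∀ i, a i < y i}

theorem isOpen_orthant (a : Fin d → ℝ) : IsOpen (orthant a) := by
  simp only [orthant, Set.ofPred_forall]
  exact isOpen_iInter_of_finite fun i => isOpen_lt continuous_const (continuous_apply i)

theorem update_mem_orthant {a x : Fin d → ℝ} (hx : x ∈ orthant a) {i : Fin d} {s : ℝ} :
    Function.update x i s ∈ orthant a ↔ a i < s := by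
  refine ⟨fun h => by simpa using h i, fun h l => ?_⟩
  by_cases hl : l = i
  · subst hl; simpa using h
  · simpa [hl] using hx l

section Orthant

variable {a : Fin d → ℝ} {T : Matrix (Fin d) (Fin d) ℝ} {b : Fin d → ℝ} {c : ℝ}

theorem extend_orthant_update {f : (Fin d → ℝ) → ℝ} {x : Fin d → ℝ} (hx : x ∈ orthant a)
    (i : Fin d) (s : ℝ) : extend (orthant a) f (Function.update x i s) =
      (Set.Ioi (a i)).indicator (fun s => ENNReal.ofReal (f (Function.update x i s))) s := by
  simp only [extend, Set.indicator, update_mem_orthant hx, Set.mem_Ioi]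

theorem lmarginal_singleton_expQuadLog_ne_top (ha : ∀ l, 0 ≤ a l) (hT : Tᵀ = T) {i : Fin d}
    (hi : 0 < T i i) {x : Fin d → ℝ} (hx : x ∈ orthant a) :
    lmarginal (fun _ => volume) {i} (extend (orthant a) (expQuadLog T b c)) x ≠ ∞ := by
  obtain ⟨C, hC⟩ := exists_expQuadLog_update_le (b := b) (c := c) hT hi x
  rw [lmarginal_singleton]
  have hint : Integrable fun s : ℝ => C * (1 + s ^ 2)⁻¹ := integrable_inv_one_add_sq.const_mul C
  refine ne_top_of_le_ne_top hint.lintegral_lt_top.ne (lintegral_mono fun s => ?_)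
  rw [extend_orthant_update hx]
  refine Set.indicator_le' (f := fun s => ENNReal.ofReal (expQuadLog T b c (Function.update x i s)))
    (g := fun s => ENNReal.ofReal (C * (1 + s ^ 2)⁻¹)) (fun s hs => ?_) (fun s _ => zero_le) s
  exact ENNReal.ofReal_le_ofReal (hC s ((ha i).trans_lt hs))

theorem lmarginal_singleton_extend_ne_zero {f : (Fin d → ℝ) → ℝ} (hf : Measurable f)
    (hpos : ∀ y, 0 < f y) (i : Fin d) {x : Fin d → ℝ} (hx : x ∈ orthant a) :
    lmarginal (fun _ => volume) {i} (extend (orthant a) f) x ≠ 0 := by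
  rw [lmarginal_singleton]
  simp only [extend_orthant_update hx]
  rw [lintegral_indicator measurableSet_Ioi]
  have hm : Measurable fun s => ENNReal.ofReal (f (Function.update x i s)) :=
    (hf.comp (measurable_update x)).ennreal_ofReal
  refine ((setLIntegral_pos_iff hm).2 ?_).ne'
  have : (Function.support fun s => ENNReal.ofReal (f (Function.update x i s))) = Set.univ := by
    ext s
    simp [hpos]
  rw [this, Set.univ_inter, Real.volume_Ioi]
  exact ENNReal.zero_lt_top

theorem condIndepLaw_orthant_iff {ν : Measure (Fin d → ℝ)} (ha : ∀ l, 0 ≤ a l) (hT : Tᵀ = T)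
    {i j : Fin d} (hij : i ≠ j) (hi : 0 < T i i) (hj : 0 < T j j)
    (hν : HasPosContDensity ν (orthant a) (expQuadLog T b c)) :
    CondIndepLaw ν (orthant a) {i} {i, j}ᶜ {j} ↔ T i j = 0 := by
  rw [condIndepLaw_iff_of_hasPosContDensity (isOpen_orthant a) hν]
  constructor
  · intro h
    -- A single rectangle suffices: since `a l ≥ 0`, the increments `log (a l + 2) - log (a l + 1)`
    -- are nonzero.
    set x : Fin d → ℝ := fun l => a l + 1
    have hx : x ∈ orthant a := fun l => lt_add_one (a l)
    have hs : Function.update x i (a i + 2) ∈ orthant a :=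
      (update_mem_orthant hx).2 (by linarith)
    have ht : Function.update x j (a j + 2) ∈ orthant a :=
      (update_mem_orthant hx).2 (by linarith)
    have hrect := mul_eq_mul_of_forall_eq_marginal hij h hx hs ht
      ((update_mem_orthant hs).2 (by linarith))
    rw [← ENNReal.ofReal_mul (expQuadLog_pos _).le, ← ENNReal.ofReal_mul (expQuadLog_pos _).le,
      ENNReal.ofReal_eq_ofReal_iff (mul_pos (expQuadLog_pos _) (expQuadLog_pos _)).le
        (mul_pos (expQuadLog_pos _) (expQuadLog_pos _)).le, expQuadLog_update_update hT hij,
      mul_eq_left₀ (mul_pos (expQuadLog_pos _) (expQuadLog_pos _)).ne', Real.exp_eq_one_iff,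
      neg_eq_zero] at hrect
    have hlog : ∀ l, Real.log (a l + 2) - Real.log (x l) ≠ 0 := fun l => by
      have h1 := ha l
      exact (sub_pos.2 (Real.log_lt_log (by positivity) (by simp only [x]; linarith))).ne'
    simpa [hlog] using hrect
  · intro h x hx
    have hF : Measurable (extend (orthant a) (expQuadLog T b c)) :=
      measurable_expQuadLog.ennreal_ofReal.indicator (isOpen_orthant a).measurableSet
    have hFx : extend (orthant a) (expQuadLog T b c) x = ENNReal.ofReal (expQuadLog T b c x) :=
      Set.indicator_of_mem hx _
    -- The orthant is a product set, so if `s` or `t` leaves its range, both sides vanish.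
    have hmul := lmarginal_pair_mul hF hij (x := x) (by simp [hFx]) (fun s t => by
      by_cases hs : a i < s
      · have hs' := (update_mem_orthant hx).2 hs
        by_cases ht : a j < t
        · have ht' := (update_mem_orthant hx).2 ht
          have hst' := (update_mem_orthant hs').2 ht
          simp only [extend, Set.indicator_of_mem, hx, hs', ht', hst']
          rw [← ENNReal.ofReal_mul (expQuadLog_pos _).le,
            ← ENNReal.ofReal_mul (expQuadLog_pos _).le, expQuadLog_update_update hT hij, h]
          simp
        · rw [extend_orthant_update hx j, extend_orthant_update hs' j]
          simp [ht]
      · rw [Function.update_comm hij, extend_orthant_update hx i]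
        have : Function.update (Function.update x j t) i s ∉ orthant a := fun hc =>
          hs (by simpa using hc i)
        simp [hs, extend, this])
    have c1 : ({i} ∪ {i, j}ᶜ : Finset (Fin d))ᶜ = {j} := by
      ext l
      simp only [Finset.mem_compl, Finset.mem_union, Finset.mem_singleton, Finset.mem_insert]
      grind
    have c2 : ({i, j}ᶜ ∪ {j} : Finset (Fin d))ᶜ = {i} := by
      ext l
      simp only [Finset.mem_compl, Finset.mem_union, Finset.mem_singleton, Finset.mem_insert]
      grind
    have hi0 := lmarginal_singleton_extend_ne_zero (a := a)
      (measurable_expQuadLog (T := T) (b := b) (c := c)) expQuadLog_pos i hx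
    have hj0 := lmarginal_singleton_extend_ne_zero (a := a)
      (measurable_expQuadLog (T := T) (b := b) (c := c)) expQuadLog_pos j hx
    have hit := lmarginal_singleton_expQuadLog_ne_top (b := b) (c := c) ha hT hi hx
    have hjt := lmarginal_singleton_expQuadLog_ne_top (b := b) (c := c) ha hT hj hx
    simp only [marginal, c1, c2, compl_compl]
    -- Dividing in `ℝ≥0∞` needs a denominator other than `0` and `∞`. Both follow from `hmul`, as
    -- the one-coordinate integrals are positive and finite.
    rw [← hFx, ENNReal.eq_div_iff, hmul, mul_comm]
    · intro h0
      rw [h0, zero_mul] at hmul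
      exact mul_ne_zero hi0 hj0 hmul.symm
    · intro h0
      rw [h0, ENNReal.top_mul (by simp [hFx, expQuadLog_pos])] at hmul
      exact ENNReal.mul_ne_top hit hjt hmul.symm

end Orthant

/-! ### The laws of the conditioned vectors -/

theorem lSpaceAt_eq_orthant (k : Fin d) : lSpaceAt k = orthant (Pi.single k 1) := by
  ext y
  simp only [lSpaceAt, lSpace, orthant, Set.mem_ofPred_eq]
  constructor
  · rintro ⟨⟨h, -⟩, hk⟩ i
    by_cases hi : i = k
    · subst hi; simpa using hk
    · simpa [hi] using h i
  · intro h
    have hk : 1 < y k := by simpa using h k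
    refine ⟨⟨fun i => ?_, k, hk⟩, hk⟩
    by_cases hi : i = k
    · subst hi; linarith
    · simpa [hi] using h i

theorem measurableSet_lSpace : MeasurableSet (lSpace d) := by
  unfold lSpace
  measurability

theorem IsVariogram.exists_hrParetoLaw_eq {Γ : Matrix (Fin d) (Fin d) ℝ} (hΓ : IsVariogram Γ)
    (m : Fin d) (hprob : hrParetoLaw Γ m Set.univ = 1) :
    ∃ b c, hrParetoLaw Γ m =
      volume.withDensity (extend (lSpace d) (expQuadLog (precision Γ m) b c)) := by
  obtain ⟨b, c, h⟩ := hΓ.exists_hrDensity_eq m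
  have hdens : ∀ y ∈ lSpace d, hrDensity Γ m y = expQuadLog (precision Γ m) b c y :=
    fun y hy => h y hy.1
  have hcoef : hrCoefficient Γ m =
      ∫⁻ y in lSpace d, ENNReal.ofReal (expQuadLog (precision Γ m) b c y) :=
    setLIntegral_congr_fun measurableSet_lSpace fun y hy => by
      simp only [hdens y hy]
  -- Total mass one replaces a computation of `Λ(1)`: if `Λ(1)` were `0` or `∞`, this product would
  -- be `0` in `ℝ≥0∞`.
  have hone : hrCoefficient Γ m * (hrCoefficient Γ m)⁻¹ = 1 := by
    rw [← hprob, hrParetoLaw, withDensity_apply _ MeasurableSet.univ, Measure.restrict_univ]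
    simp only [div_eq_mul_inv]
    rw [setLIntegral_congr_fun (g := fun y =>
      ENNReal.ofReal (expQuadLog (precision Γ m) b c y) * (hrCoefficient Γ m)⁻¹)
      measurableSet_lSpace (fun y hy => by simp only [hdens y hy]),
      lintegral_mul_const _ measurable_expQuadLog.ennreal_ofReal, ← hcoef]
  have h0 : hrCoefficient Γ m ≠ 0 := by
    intro h0
    simp [h0] at hone
  have htop : hrCoefficient Γ m ≠ ∞ := by
    intro h0
    simp [h0] at hone
  refine ⟨b, c + Real.log (hrCoefficient Γ m).toReal⁻¹, ?_⟩
  have hpos := ENNReal.toReal_pos h0 htop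
  rw [hrParetoLaw, ← withDensity_indicator measurableSet_lSpace]
  congr 1
  refine Set.indicator_congr fun y hy => ?_
  rw [expQuadLog_add_const, Real.exp_log (inv_pos.2 hpos), hdens y hy,
    ENNReal.ofReal_mul (inv_pos.2 hpos).le, ENNReal.ofReal_inv_of_pos hpos,
    ENNReal.ofReal_toReal htop, mul_comm, div_eq_mul_inv]

theorem IsHRPareto.exists_hasPosContDensity {Ω : Type*} [MeasurableSpace Ω] {P : Measure Ω}
    [IsProbabilityMeasure P] {Y : Ω → Fin d → ℝ} {Γ : Matrix (Fin d) (Fin d) ℝ}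
    (hΓ : IsVariogram Γ) (hY : IsHRPareto P Y Γ) (k : Fin d) :
    ∃ b c, HasPosContDensity (conditionedLaw P Y k) (lSpaceAt k)
      (expQuadLog (precision Γ k) b c) := by
  obtain ⟨m, hm⟩ := hY
  have hprob : hrParetoLaw Γ m Set.univ = 1 := by
    have := Measure.isProbabilityMeasure_map (μ := P) hm.aemeasurable
    rw [← hm.map_eq, measure_univ]
  obtain ⟨b, c, hlaw⟩ := hΓ.exists_hrParetoLaw_eq m hprob
  rw [hΓ.precision_eq m k] at hlaw
  set S : Set (Fin d → ℝ) := {y | 1 < y k}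
  have hS : MeasurableSet S := measurableSet_lt measurable_const (measurable_pi_apply k)
  have hopen : IsOpen (lSpaceAt k) := lSpaceAt_eq_orthant k ▸ isOpen_orthant _
  have hinter : S ∩ lSpace d = lSpaceAt k := by
    ext y
    exact and_comm
  have hPS : P {ω | 1 < Y ω k} = P.map Y S :=
    (Measure.map_apply_of_aemeasurable hm.aemeasurable hS).symm
  -- The density is positive on `lSpaceAt k`, which is open and contains the constant vector `2`, so
  -- the conditioning is not degenerate.
  have hne : P {ω | 1 < Y ω k} ≠ 0 := by
    have hmeas : Measurable (extend (lSpace d) (expQuadLog (precision Γ k) b c)) :=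
      measurable_expQuadLog.ennreal_ofReal.indicator measurableSet_lSpace
    rw [hPS, hm.map_eq, hlaw, Ne, withDensity_apply_eq_zero hmeas]
    have : {y | extend (lSpace d) (expQuadLog (precision Γ k) b c) y ≠ 0} ∩ S = lSpaceAt k := by
      rw [← hinter, Set.inter_comm]
      congr 1
      ext y
      simp [extend, expQuadLog_pos]
    rw [this]
    refine (hopen.measure_pos volume ⟨fun _ => 2, ?_⟩).ne'
    exact ⟨⟨fun _ => two_pos, k, one_lt_two⟩, one_lt_two⟩
  have htop : P {ω | 1 < Y ω k} ≠ ∞ := measure_ne_top P _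
  have hpos := ENNReal.toReal_pos hne htop
  -- Conditioning rescales the density by `1 / P(Y_k > 1)`, which is absorbed into the constant
  -- term.
  refine ⟨b, c + Real.log (P {ω | 1 < Y ω k}).toReal⁻¹, ?_, fun _ _ => expQuadLog_pos _, ?_⟩
  · exact continuousOn_expQuadLog.mono fun y hy => hy.1.1
  · rw [conditionedLaw, ProbabilityTheory.cond, Measure.map_smul]
    have hr : (P.restrict {ω | 1 < Y ω k}).map Y = (P.map Y).restrict S :=
      (Measure.restrict_map_of_aemeasurable hm.aemeasurable hS).symm
    rw [hr, hm.map_eq, hlaw, restrict_withDensity hS, ← withDensity_indicator hS,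
      ← withDensity_smul' _ _ (ENNReal.inv_ne_top.2 hne)]
    congr 1
    ext y
    rw [Pi.smul_apply, extend, Set.indicator_indicator, hinter, extend, ← hinter]
    by_cases hy : y ∈ S ∩ lSpace d
    swap
    · simp [Set.indicator_of_notMem hy]
    rw [Set.indicator_of_mem hy, Set.indicator_of_mem hy, smul_eq_mul]
    rw [expQuadLog_add_const, Real.exp_log (inv_pos.2 hpos), ENNReal.ofReal_mul
      (inv_pos.2 hpos).le, ENNReal.ofReal_inv_of_pos hpos, ENNReal.ofReal_toReal htop]

theorem extremalCondIndep_iff_precision_eq_zero {Ω : Type*} [MeasurableSpace Ω] {P : Measure Ω}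
    [IsProbabilityMeasure P] {Y : Ω → Fin d → ℝ} {Γ : Matrix (Fin d) (Fin d) ℝ}
    (hΓ : IsVariogram Γ) (hY : IsHRPareto P Y Γ) {i j : Fin d} (hij : i ≠ j) (k : Fin d) :
    ExtremalCondIndep P Y {i} {i, j}ᶜ {j} ↔ precision Γ k i j = 0 := by
  have h : ∀ m, CondIndepLaw (conditionedLaw P Y m) (lSpaceAt m) {i} {i, j}ᶜ {j} ↔
      precision Γ k i j = 0 := by
    intro m
    obtain ⟨b, c, hf⟩ := hY.exists_hasPosContDensity hΓ m
    rw [lSpaceAt_eq_orthant] at hf ⊢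
    rw [condIndepLaw_orthant_iff (fun l => ?_) (hΓ.precision_symm m) hij
      (hΓ.precision_diag_pos m hij) (hΓ.precision_diag_pos m hij.symm) hf, hΓ.precision_eq m k]
    exact (Pi.single_nonneg (α := fun _ => ℝ) (i := m)).2 zero_le_one l
  exact ⟨fun hc => (h k).1 (hc k), fun hc m => (h m).2 hc⟩

end ExtremalGraph

theorem proposition4 {d : ℕ} (hd : 3 ≤ d)
    {Ω : Type*} [MeasurableSpace Ω] (P : Measure Ω) [IsProbabilityMeasure P]
    (Y : Ω → Fin d → ℝ) (Γ : Matrix (Fin d) (Fin d) ℝ)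
    (hΓ : ExtremalGraph.IsVariogram Γ) (hY : ExtremalGraph.IsHRPareto P Y Γ)
    (i j : Fin d) (hij : i ≠ j) (k : Fin d) :
    (∀ (hi : i ≠ k) (hj : j ≠ k),
      (ExtremalGraph.ExtremalCondIndep P Y {i} {i, j}ᶜ {j} ↔
        ExtremalGraph.theta Γ k ⟨i, hi⟩ ⟨j, hj⟩ = 0)) ∧
    (∀ (_ : i = k) (hj : j ≠ k),
      (ExtremalGraph.ExtremalCondIndep P Y {i} {i, j}ᶜ {j} ↔
        ∑ l, ExtremalGraph.theta Γ k l ⟨j, hj⟩ = 0)) ∧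
    (∀ (_ : j = k) (hi : i ≠ k),
      (ExtremalGraph.ExtremalCondIndep P Y {i} {i, j}ᶜ {j} ↔
        ∑ l, ExtremalGraph.theta Γ k ⟨i, hi⟩ l = 0)) := by
  rw [ExtremalGraph.extremalCondIndep_iff_precision_eq_zero hΓ hY hij k]
  refine ⟨fun hi hj => ?_, fun hik hj => ?_, fun hjk hi => ?_⟩
  · rw [← ExtremalGraph.precision_apply_of_ne k ⟨i, hi⟩ ⟨j, hj⟩]
  · rw [hik, hΓ.precision_apply_self_left k ⟨j, hj⟩, neg_eq_zero]
  · rw [hjk, ExtremalGraph.precision_apply_self_right k ⟨i, hi⟩, neg_eq_zero]
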